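/- A group $H$ is called \emph{strongly bounded} if every isometric action of $H$ on a metric space has bounded orbits. Every group embeds in a strongly bounded group. More precisely, for every group $G$, with cardinality $|G|=\kappa$, there exist a strongly bounded group $H$ of cardinality $|H|=\kappa^{\aleph_0}$ and an injective group homomorphism $G\to H$. -/

import Mathlib

universe u v

/-- A group is strongly bounded if every isometric action of it on a metric space has bounded
orbits. The metric spaces range over the universe of the group; the fact
`IsStronglyBounded.isBounded_orbit` below shows that this covers the metric spaces of every
universe. -/
def IsStronglyBounded (G : Type u) [Group G] : Prop :=
  ∀ (X : Type u) [MetricSpace X] [MulAction G X] [IsIsometricSMul G X] (x : X),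
    Bornology.IsBounded (MulAction.orbit G x)

/-- The universe of the metric spaces does not matter: an orbit is a copy of a coset space. -/
theorem IsStronglyBounded.isBounded_orbit {G : Type u} [Group G] (hG : IsStronglyBounded G)
    (X : Type v) [MetricSpace X] [MulAction G X] [IsIsometricSMul G X] (x : X) :
    Bornology.IsBounded (MulAction.orbit G x) := by
  let φ : G ⧸ MulAction.stabilizer G x → X := MulAction.ofQuotientStabilizer G x
  have hφ : Function.Injective φ := MulAction.injective_ofQuotientStabilizer G x
  have hsmul : ∀ (g : G) (q : G ⧸ MulAction.stabilizer G x), φ (g • q) = g • φ q :=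
    fun g q => MulAction.ofQuotientStabilizer_smul G x g q
  letI : MetricSpace (G ⧸ MulAction.stabilizer G x) := MetricSpace.induced φ hφ inferInstance
  have hiso : Isometry φ := fun _ _ => rfl
  haveI : IsIsometricSMul G (G ⧸ MulAction.stabilizer G x) := ⟨fun g p q => by
    rw [← hiso.edist_eq, ← hiso.edist_eq, hsmul, hsmul, edist_smul_left]⟩
  have h := hG (G ⧸ MulAction.stabilizer G x) ((1 : G) : G ⧸ MulAction.stabilizer G x)
  refine (hiso.lipschitz.isBounded_image h).subset ?_
  rintro _ ⟨g, rfl⟩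
  refine ⟨g • ((1 : G) : G ⧸ MulAction.stabilizer G x), ⟨g, rfl⟩, ?_⟩
  rw [hsmul]
  change g • (1 : G) • x = g • x
  rw [one_smul]

open scoped commutatorElement

/-! If every sequence `f m` is a word of length linear in `m` in three fixed elements, an unbounded
orbit would allow `f m` with displacement above `m ^ 2`, which linear words cannot reach
(`HasLinearWords.isStronglyBounded`).

Permutations of a power set with small support have this property (`hasLinearWords_smallPerm`): a
sequence has small joint support, leaving room for a grid of copies of it on which shifts generate
the sequence. Closing the image of `ℕ → G` under Skolem functions gives a subgroup of the right size
(`HasLinearWords.exists_subgroup`). -/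

/-- Every sequence in the group is expressed by words of linear length in three elements. -/
def HasLinearWords (G : Type u) [Group G] : Prop :=
  ∀ f : ℕ → G, ∃ a b t : G, ∀ m, f m = ⁅(t ^ m)⁻¹ * a * t ^ m, b⁆

section Displacement

variable {G : Type u} [Group G] {X : Type v} [MetricSpace X] [MulAction G X]
  [IsIsometricSMul G X]

theorem dist_mul_smul_le (g h : G) (x : X) :
    dist ((g * h) • x) x ≤ dist (g • x) x + dist (h • x) x := by
  calc dist ((g * h) • x) x ≤ dist ((g * h) • x) (g • x) + dist (g • x) x := dist_triangle _ _ _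
    _ = dist (g • x) x + dist (h • x) x := by rw [mul_smul, dist_smul, add_comm]

theorem dist_inv_smul_self (g : G) (x : X) : dist (g⁻¹ • x) x = dist (g • x) x := by
  rw [← dist_smul g, smul_inv_smul, dist_comm]

theorem dist_pow_smul_le (g : G) (x : X) (n : ℕ) :
    dist (g ^ n • x) x ≤ n * dist (g • x) x := by
  induction n with
  | zero => simp
  | succ n ih =>
    rw [pow_succ]
    push_cast
    linarith [dist_mul_smul_le (g ^ n) g x]

theorem dist_commutator_smul_le (g h : G) (x : X) :
    dist (⁅g, h⁆ • x) x ≤ 2 * (dist (g • x) x + dist (h • x) x) := by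
  rw [commutatorElement_def]
  linarith [dist_mul_smul_le (g * h * g⁻¹) h⁻¹ x, dist_mul_smul_le (g * h) g⁻¹ x,
    dist_mul_smul_le g h x, dist_inv_smul_self g x, dist_inv_smul_self h x]

end Displacement

theorem HasLinearWords.isStronglyBounded {G : Type u} [Group G] (hG : HasLinearWords G) :
    IsStronglyBounded G := by
  intro X _ _ _ x
  suffices h : ∃ r : ℝ, ∀ g : G, dist (g • x) x ≤ r by
    obtain ⟨r, hr⟩ := h
    refine (Metric.isBounded_closedBall (x := x) (r := r)).subset ?_
    rintro _ ⟨g, rfl⟩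
    exact hr g
  by_contra! h
  choose f hf using fun n : ℕ => h ((n : ℝ) ^ 2)
  obtain ⟨a, b, t, hfm⟩ := hG f
  -- The word for `f n` moves `x` by at most `4n|t| + 2|a| + 2|b|`, writing `|g|` for the
  -- displacement of `x` by `g`; the `+ 1` ensures `1 ≤ n`.
  obtain ⟨n, hn⟩ :=
    exists_nat_gt (4 * dist (t • x) x + 2 * dist (a • x) x + 2 * dist (b • x) x + 1)
  have h1 := hf n
  rw [hfm n] at h1
  have h2 := dist_commutator_smul_le ((t ^ n)⁻¹ * a * t ^ n) b x
  have h3 := dist_mul_smul_le ((t ^ n)⁻¹ * a) (t ^ n) x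
  have h4 := dist_mul_smul_le ((t ^ n)⁻¹) a x
  rw [dist_inv_smul_self] at h4
  have h5 := dist_pow_smul_le t x n
  have ha := dist_nonneg (x := a • x) (y := x)
  have hb := dist_nonneg (x := b • x) (y := x)
  have ht := dist_nonneg (x := t • x) (y := x)
  have hn1 : (1 : ℝ) ≤ n := by linarith
  nlinarith [mul_le_mul_of_nonneg_right hn1 ha, mul_le_mul_of_nonneg_right hn1 hb]

/-! ### Shifts and commutators on a grid -/

section Grid

variable {S : Type u}

/-- The permutation acting by `p` on the cell `(0, 0)` of the grid. -/
def cellPerm (p : Equiv.Perm S) : Equiv.Perm (S × ℤ × ℤ) where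
  toFun q := if q.2 = (0, 0) then (p q.1, q.2) else q
  invFun q := if q.2 = (0, 0) then (p.symm q.1, q.2) else q
  left_inv := fun ⟨x, q⟩ => by by_cases h : q = (0, 0) <;> simp [h]
  right_inv := fun ⟨x, q⟩ => by by_cases h : q = (0, 0) <;> simp [h]

/-- The permutation acting by `f i` on the nonnegative half of the row `i` of the grid. -/
def halfRowPerm (f : ℤ → Equiv.Perm S) : Equiv.Perm (S × ℤ × ℤ) where
  toFun q := if 0 ≤ q.2.2 then (f q.2.1 q.1, q.2) else q
  invFun q := if 0 ≤ q.2.2 then ((f q.2.1).symm q.1, q.2) else q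
  left_inv q := by by_cases h : 0 ≤ q.2.2 <;> simp [h]
  right_inv q := by by_cases h : 0 ≤ q.2.2 <;> simp [h]

/-- The shift of the row `0` of the grid. -/
def rowShift : Equiv.Perm (S × ℤ × ℤ) where
  toFun q := if q.2.1 = 0 then (q.1, q.2.1, q.2.2 + 1) else q
  invFun q := if q.2.1 = 0 then (q.1, q.2.1, q.2.2 - 1) else q
  left_inv := fun ⟨x, i, k⟩ => by by_cases h : i = 0 <;> simp [h]
  right_inv := fun ⟨x, i, k⟩ => by by_cases h : i = 0 <;> simp [h]

/-- The shift moving each row of the grid to the next one. -/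
def columnShift : Equiv.Perm (S × ℤ × ℤ) where
  toFun q := (q.1, q.2.1 + 1, q.2.2)
  invFun q := (q.1, q.2.1 - 1, q.2.2)
  left_inv q := by simp
  right_inv q := by simp

theorem columnShift_pow_apply (m : ℕ) (q : S × ℤ × ℤ) :
    (columnShift ^ m) q = (q.1, q.2.1 + m, q.2.2) := by
  induction m with
  | zero => simp
  | succ m ih =>
    rw [pow_succ', Equiv.Perm.mul_apply, ih]
    simp [columnShift, add_assoc]

theorem conj_columnShift_halfRowPerm (f : ℤ → Equiv.Perm S) (m : ℕ) :
    (columnShift ^ m)⁻¹ * halfRowPerm f * columnShift ^ m =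
      halfRowPerm fun i => f (i + m) := by
  rw [mul_assoc, inv_mul_eq_iff_eq_mul]
  ext1 ⟨x, i, k⟩
  simp only [Equiv.Perm.mul_apply, columnShift_pow_apply, halfRowPerm, Equiv.coe_fn_mk]
  by_cases h : 0 ≤ k <;> simp [h]

/-- Conjugating by the shift makes the half of row `0` start one cell later and changes no other
row, so everything cancels except the cell `(0, 0)`. -/
theorem commutator_halfRowPerm_rowShift (f : ℤ → Equiv.Perm S) :
    ⁅halfRowPerm f, rowShift⁆ = cellPerm (f 0) := by
  rw [commutatorElement_def, mul_inv_eq_iff_eq_mul, mul_inv_eq_iff_eq_mul]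
  ext1 ⟨x, i, k⟩
  simp only [Equiv.Perm.mul_apply, halfRowPerm, rowShift, cellPerm, Equiv.coe_fn_mk]
  by_cases hi : i = 0
  · subst hi
    rcases lt_trichotomy k (-1) with hk | rfl | hk
    · have h1 : ¬ 0 ≤ k := by omega
      have h2 : ¬ 0 ≤ k + 1 := by omega
      have h3 : k + 1 ≠ 0 := by omega
      simp [h1, h2, h3]
    · simp
    · have h1 : 0 ≤ k := by omega
      have h2 : 0 ≤ k + 1 := by omega
      have h3 : k + 1 ≠ 0 := by omega
      simp [h1, h2, h3]
  · by_cases hk : 0 ≤ k <;> simp [hi, hk]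

theorem cellPerm_eq_commutator (f : ℕ → Equiv.Perm S) (m : ℕ) :
    cellPerm (f m) =
      ⁅(columnShift ^ m)⁻¹ * halfRowPerm (fun i => f i.toNat) * columnShift ^ m, rowShift⁆ := by
  rw [conj_columnShift_halfRowPerm, commutator_halfRowPerm_rowShift]
  simp

end Grid

/-! ### Permutations of small support -/

section SmallSupport

open Cardinal

/-- The permutations of the power set of `X` which move at most `#X` points. -/
def smallPerm (X : Type u) [Infinite X] : Subgroup (Equiv.Perm (Set X)) where
  carrier := {p | #{y | p y ≠ y} ≤ #X}
  one_mem' := by simp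
  mul_mem' {p q} hp hq := by
    have h : {y | (p * q) y ≠ y} ⊆ {y | p y ≠ y} ∪ {y | q y ≠ y} := by
      intro y hy
      by_contra h
      simp only [Set.mem_union, Set.mem_ofPred_eq, not_or, not_not] at h
      exact hy (by rw [Equiv.Perm.mul_apply, h.2, h.1])
    change #{y | (p * q) y ≠ y} ≤ #X
    refine (mk_le_mk_of_subset h).trans ((mk_union_le _ _).trans ?_)
    exact add_le_of_le (aleph0_le_mk X) hp hq
  inv_mem' {p} hp := by
    have h : {y | p⁻¹ y ≠ y} = {y | p y ≠ y} := by
      ext y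
      simp only [Set.mem_ofPred_eq, ne_eq, Equiv.Perm.inv_eq_iff_eq]
      exact not_congr eq_comm
    simpa only [Set.mem_ofPred_eq, h] using hp

variable {X : Type u} [Infinite X]

theorem extendDomain_mem_smallPerm {T : Type u} (hT : #T ≤ #X) {D : Set (Set X)}
    [DecidablePred (· ∈ D)] (e : T ≃ D) (p : Equiv.Perm T) : p.extendDomain e ∈ smallPerm X := by
  have h : {y | p.extendDomain e y ≠ y} ⊆ D := by
    intro y hy
    by_contra hD
    exact hy (Equiv.Perm.extendDomain_apply_not_subtype p e hD)
  exact (mk_le_mk_of_subset h).trans ((mk_congr e).symm.le.trans hT)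

theorem mk_prod_int_int_le {S : Type u} (hS : #S ≤ #X) : #(S × ℤ × ℤ) ≤ #X := by
  have h : #(S × ℤ × ℤ) = #S * ℵ₀ := by simp
  rw [h]
  exact (mul_le_mul' hS (aleph0_le_mk X)).trans (mul_eq_self (aleph0_le_mk X)).le

/-- By Cantor's theorem the complement of `S` is large enough to hold all the other cells. -/
theorem exists_grid_injective (S : Set (Set X)) (hS : #S ≤ #X) :
    ∃ e : S × ℤ × ℤ → Set X, Function.Injective e ∧ ∀ x : S, e (x, 0, 0) = x := by
  have hY : #X < #(Set X) := by rw [mk_set]; exact cantor _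
  have hc : #(Sᶜ : Set (Set X)) = #(Set X) := by
    exact mk_compl_of_infinite S (hS.trans_lt hY)
  obtain ⟨j⟩ : Nonempty (S × ℤ × ℤ ↪ (Sᶜ : Set (Set X))) := by
    rw [← Cardinal.le_def, hc]
    exact (mk_prod_int_int_le hS).trans hY.le
  refine ⟨fun q => if q.2 = (0, 0) then q.1 else j q, ?_, fun x => by simp⟩
  intro p q h
  by_cases hp : p.2 = (0, 0) <;> by_cases hq : q.2 = (0, 0) <;> simp only [hp, hq, if_true,
    if_false] at h
  · exact Prod.ext (Subtype.ext h) (hp.trans hq.symm)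
  · exact absurd p.1.2 (h ▸ (j q).2)
  · exact absurd q.1.2 (h ▸ (j p).2)
  · exact j.injective (Subtype.ext h)

theorem hasLinearWords_smallPerm : HasLinearWords (smallPerm X) := by
  classical
  intro f
  let S : Set (Set X) := ⋃ n, {y | (f n : Equiv.Perm (Set X)) y ≠ y}
  have hS : #S ≤ #X := by
    rw [← lift_le.{0}]
    refine (mk_iUnion_le_lift _).trans ?_
    have h : (⨆ n, #{y | (f n : Equiv.Perm (Set X)) y ≠ y}) ≤ #X := ciSup_le' fun n => (f n).2
    have h2 := (mul_le_mul' (aleph0_le_mk X) h).trans (mul_eq_self (aleph0_le_mk X)).le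
    simpa using h2
  have hfS : ∀ n y, y ∈ S ↔ (f n : Equiv.Perm (Set X)) y ∈ S := by
    intro n y
    by_cases hy : (f n : Equiv.Perm (Set X)) y = y
    · rw [hy]
    · exact iff_of_true (Set.mem_iUnion.2 ⟨n, hy⟩)
        (Set.mem_iUnion.2 ⟨n, fun h => hy (Equiv.injective _ h)⟩)
  obtain ⟨e, he, he0⟩ := exists_grid_injective S hS
  let E : S × ℤ × ℤ ≃ Set.range e := Equiv.ofInjective e he
  let φ := Equiv.Perm.extendDomainHom E
  have hT := mk_prod_int_int_le hS
  let g : ℕ → Equiv.Perm S := fun n => (f n : Equiv.Perm (Set X)).subtypePerm fun y => (hfS n y).symm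
  refine ⟨⟨φ (halfRowPerm fun i => g i.toNat), extendDomain_mem_smallPerm hT _ _⟩,
    ⟨φ rowShift, extendDomain_mem_smallPerm hT _ _⟩,
    ⟨φ columnShift, extendDomain_mem_smallPerm hT _ _⟩, fun m => Subtype.ext ?_⟩
  have h : (f m : Equiv.Perm (Set X)) = φ (cellPerm (g m)) := by
    ext1 y
    by_cases hy : y ∈ Set.range e
    · obtain ⟨⟨x, q⟩, rfl⟩ := hy
      refine Eq.trans ?_ (Equiv.Perm.extendDomain_apply_image _ E (x, q)).symm
      change _ = e (cellPerm (g m) (x, q))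
      by_cases hq : q = (0, 0)
      · subst hq
        simp [cellPerm, he0, g]
      · have hx : e (x, q) ∉ S := fun hS => hq (congrArg Prod.snd (he (he0 ⟨_, hS⟩))).symm
        simp only [cellPerm, Equiv.coe_fn_mk, hq, if_false]
        by_contra hne
        exact hx (Set.mem_iUnion.2 ⟨m, hne⟩)
    · refine Eq.trans ?_ (Equiv.Perm.extendDomain_apply_not_subtype _ E hy).symm
      by_contra hne
      exact hy ⟨(⟨y, Set.mem_iUnion.2 ⟨m, hne⟩⟩, 0, 0), he0 _⟩
  rw [h, cellPerm_eq_commutator, map_commutatorElement]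
  simp only [map_mul, map_inv, map_pow]
  rfl

theorem exists_injective_hom_smallPerm (G : Type u) [Group G] [Infinite G] :
    ∃ f : G →* smallPerm G, Function.Injective f := by
  classical
  let E : G ≃ Set.range (fun g : G => ({g} : Set G)) :=
    Equiv.ofInjective _ Set.singleton_injective
  refine ⟨((Equiv.Perm.extendDomainHom E).comp (MulAction.toPermHom G G)).codRestrict _
    fun g => extendDomain_mem_smallPerm le_rfl E _, ?_⟩
  refine (MonoidHom.injective_codRestrict _ _ _).2 ?_
  exact (Equiv.Perm.extendDomainHom_injective E).comp MulAction.toPerm_injective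

end SmallSupport

/-! ### Closure under countable operations -/

section Terms

open Cardinal

/-- Terms over the variables `A` in countably many operations of countable arity. -/
inductive CountableTerm (A : Type u) : Type u
  | var : A → CountableTerm A
  | app : ℕ → (ℕ → CountableTerm A) → CountableTerm A

namespace CountableTerm

variable {A : Type u}

/-- The label of the node of a term at a given position. -/
def label : CountableTerm A → List ℕ → A ⊕ ℕ
  | var a, _ => Sum.inl a
  | app i _, [] => Sum.inr i
  | app _ f, n :: p => label (f n) p

/-- A term is a tree, determined by its labels along finite paths; this bounds the number of terms.
-/
theorem label_injective : Function.Injective (label (A := A)) := by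
  intro s
  induction s with
  | var a =>
    rintro (b | ⟨j, g⟩) h
    · simpa [label] using congrFun h []
    · simpa [label] using congrFun h []
  | app i f ih =>
    rintro (b | ⟨j, g⟩) h
    · simpa [label] using congrFun h []
    · have hi : i = j := by simpa [label] using congrFun h []
      have hf : f = g := funext fun n => ih n (funext fun p => congrFun h (n :: p))
      rw [hi, hf]

theorem mk_le (A : Type u) : #(CountableTerm A) ≤ (#A + ℵ₀) ^ ℵ₀ := by
  simpa using mk_le_of_injective (label_injective (A := A))

/-- The value of a term under an interpretation of variables and operations. -/
def eval {P : Type v} (v : A → P) (op : ℕ → (ℕ → P) → P) : CountableTerm A → P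
  | var a => v a
  | app i f => op i fun n => eval v op (f n)

end CountableTerm

/-- A Löwenheim–Skolem theorem for `HasLinearWords`. -/
theorem HasLinearWords.exists_subgroup {P : Type u} [Group P] (hP : HasLinearWords P)
    {A : Type u} [Group A] (v : A →* P) :
    ∃ H : Subgroup P, HasLinearWords H ∧ #H ≤ (#A + ℵ₀) ^ ℵ₀ ∧ ∀ a, v a ∈ H := by
  -- Skolem functions of countable arity: a subgroup closed under them inherits the property.
  choose a b t h using hP
  let op : ℕ → (ℕ → P) → P := fun i f =>
    match i with
    | 0 => f 0 * f 1
    | 1 => (f 0)⁻¹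
    | 2 => a f
    | 3 => b f
    | _ => t f
  let ev := CountableTerm.eval v op
  have hop : ∀ (i : ℕ) (f : ℕ → P), (∀ n, f n ∈ Set.range ev) → op i f ∈ Set.range ev := by
    intro i f hf
    choose s hs using hf
    exact ⟨.app i s, congrArg (op i) (funext hs)⟩
  have hv : ∀ x, v x ∈ Set.range ev := fun x => ⟨.var x, rfl⟩
  let H : Subgroup P :=
    { carrier := Set.range ev
      one_mem' := map_one v ▸ hv 1
      mul_mem' := fun {x y} hx hy =>
        hop 0 (fun n => if n = 0 then x else y) fun n => by by_cases hn : n = 0 <;> simpa [hn]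
      inv_mem' := fun {x} hx => hop 1 (fun _ => x) fun _ => hx }
  refine ⟨H, fun f => ?_, mk_range_le.trans (CountableTerm.mk_le A), hv⟩
  have hf : ∀ n, (f n : P) ∈ Set.range ev := fun n => (f n).2
  exact ⟨⟨_, hop 2 (fun n => f n) hf⟩, ⟨_, hop 3 (fun n => f n) hf⟩,
    ⟨_, hop 4 (fun n => f n) hf⟩, fun m => Subtype.ext (h (fun n => f n) m)⟩

end Terms

theorem mainTheorem6 (G : Type u) [Group G] :
    ∃ (H : Type u) (_ : Group H),
      IsStronglyBounded H ∧
      Cardinal.mk H = Cardinal.mk G ^ Cardinal.aleph0 ∧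
      ∃ f : G →* H, Function.Injective f := by
  rcases subsingleton_or_nontrivial G with hG | hG
  · refine ⟨G, inferInstance, fun X _ _ _ x => ?_, ?_, MonoidHom.id G, Function.injective_id⟩
    · exact (Set.finite_range fun g : G => g • x).isBounded
    · rw [Cardinal.mk_eq_one, Cardinal.one_power]
  -- Passing to `ℕ → G` makes the group infinite even for finite `G`, and its cardinality is
  -- unchanged by the power `ℵ₀`.
  · have hc : Cardinal.mk (ℕ → G) = Cardinal.mk G ^ Cardinal.aleph0 := by simp
    obtain ⟨v, hv⟩ := exists_injective_hom_smallPerm (ℕ → G)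
    obtain ⟨H, hH, hle, hvH⟩ := hasLinearWords_smallPerm.exists_subgroup v
    let w : (ℕ → G) →* H := v.codRestrict H hvH
    have hw : Function.Injective w := (MonoidHom.injective_codRestrict v H hvH).2 hv
    refine ⟨H, inferInstance, hH.isStronglyBounded, le_antisymm ?_ ?_,
      w.comp (Pi.constMonoidHom ℕ G), hw.comp Function.const_injective⟩
    · rwa [Cardinal.add_eq_left (Cardinal.aleph0_le_mk _) (Cardinal.aleph0_le_mk _), hc,
        ← Cardinal.power_mul, Cardinal.aleph0_mul_aleph0] at hle
    · rw [← hc]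
      exact Cardinal.mk_le_of_injective hw
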